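/- \textbf{Bernstein doubling inequality.} For $x\in\mathbb{C}^n$ and $\rho>0$ let $B_c(x,\rho)$ denote the open Euclidean ball in $\mathbb{C}^n$ with center $x$ and radius $\rho$. For every $r>1$ there is a constant $c=c(r)>0$, depending only on $r$ (in particular not on the dimension), such that the following holds. Let $n$ be a natural number and let $f:B_c(0,r)\to[-\infty,\infty)$ be plurisubharmonic, with $$\sup_{B_c(0,r)}f\le 0\quad\text{and}\quad \sup_{B_c(0,1)}f\ge -1.$$ Let $a>1$, $t>0$ and $x\in\mathbb{C}^n$ satisfy $B_c(x,at)\subset B_c(0,1)$. Then for every $s\in[1,a]$ $$\sup_{B_c(x,st)}f\le c\,\log s+\sup_{B_c(x,t)}f.$$ -/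

import Mathlib

open Set MeasureTheory

/-- The mean value of the extended-real function `u` over the circle
`{z + e^{2 π i θ} w : 0 < θ ≤ 1}`, that is, the integral of the positive part minus the integral
of the negative part. Only the integral of the negative part may be infinite when `u` is upper
semicontinuous with values in `[-∞, ∞)`; the mean is then `-∞`. -/
noncomputable def circleMean {E : Type*} [NormedAddCommGroup E] [NormedSpace ℂ E]
    (u : E → EReal) (z w : E) : EReal :=
  ((∫⁻ θ in Ioc (0 : ℝ) 1,
      (u (z + Complex.exp (2 * Real.pi * θ * Complex.I) • w)).toENNReal : ENNReal) : EReal)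
    - ((∫⁻ θ in Ioc (0 : ℝ) 1,
      (-u (z + Complex.exp (2 * Real.pi * θ * Complex.I) • w)).toENNReal : ENNReal) : EReal)

/-- `u` is plurisubharmonic on `Ω`: it takes values in `[-∞, ∞)` there, is upper semicontinuous,
and satisfies the sub-mean value inequality on every closed disc `{z + ζ w : |ζ| ≤ 1}` of a complex
line that is contained in `Ω`. The function constantly equal to `-∞` is allowed. -/
structure IsPlurisubharmonicOn {E : Type*} [NormedAddCommGroup E] [NormedSpace ℂ E]
    (u : E → EReal) (Ω : Set E) : Prop where
  isOpen : IsOpen Ω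
  lt_top : ∀ z ∈ Ω, u z < ⊤
  upperSemicontinuousOn : UpperSemicontinuousOn u Ω
  le_circleMean : ∀ z w : E, (∀ ζ : ℂ, ‖ζ‖ ≤ 1 → z + ζ • w ∈ Ω) → u z ≤ circleMean u z w

/-! Restricted to complex lines through `x`, Hadamard's three circles theorem (`three_circles`)
gives f(z) ≤ M (1 - log s / log (R/t')), where M is the supremum over the inner ball, t' = |z - x|/s
and the ball of radius R about `x` lies in the domain. It remains to see -M ≤ c log (R/t')
(`neg_le_log`). A chain of balls from `x` to a point where f > -2 halves an upper bound at each
step, and its length depends only on `r`; so f cannot be very negative on a ball of fixed size about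
`x`. Three circles transfers this to small balls at logarithmic cost. Only one-dimensional slices
and distances enter, hence no dependence on `n`. -/

lemma coe_sub_lintegral_eq_integral {α : Type*} [MeasurableSpace α] {μ : Measure α} {k : α → ℝ}
    (hk : Integrable k μ) :
    ((∫⁻ a, (k a : EReal).toENNReal ∂μ : ENNReal) : EReal)
      - ((∫⁻ a, (-(k a : EReal)).toENNReal ∂μ : ENNReal) : EReal) = ((∫ a, k a ∂μ : ℝ) : EReal) := by
  have h1 : ∀ a, (k a : EReal).toENNReal = ENNReal.ofReal (k a) := fun a => by
    simp
  have h2 : ∀ a, (-(k a : EReal)).toENNReal = ENNReal.ofReal (-k a) := fun a => by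
    rw [← EReal.coe_neg]; simp
  simp_rw [h1, h2]
  have f1 : ∫⁻ a, ENNReal.ofReal (k a) ∂μ ≠ ⊤ :=
    ((lintegral_mono fun a => Real.ofReal_le_enorm (k a)).trans_lt hk.2).ne
  have f2 : ∫⁻ a, ENNReal.ofReal (-k a) ∂μ ≠ ⊤ := by
    refine ((lintegral_mono fun a => Real.ofReal_le_enorm (-k a)).trans_lt ?_).ne
    exact hk.neg.2
  rw [integral_eq_lintegral_pos_part_sub_lintegral_neg_part hk, EReal.coe_sub]
  conv_lhs => rw [← ENNReal.ofReal_toReal f1, ← ENNReal.ofReal_toReal f2]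
  simp only [EReal.coe_ennreal_ofReal, max_eq_left ENNReal.toReal_nonneg]

lemma integral_Ioc_eq_circleAverage (H : ℂ → ℝ) (z : ℂ) (ρ : ℝ) :
    ∫ θ in Ioc (0 : ℝ) 1, H (z + Complex.exp (2 * Real.pi * θ * Complex.I) • (ρ : ℂ))
      = Real.circleAverage H z ρ := by
  rw [Real.circleAverage_def, ← intervalIntegral.integral_of_le zero_le_one]
  have := intervalIntegral.integral_comp_mul_left (a := 0) (b := 1)
    (fun θ => H (circleMap z ρ θ)) (c := 2 * Real.pi) (by positivity)
  simp only [mul_zero, mul_one] at this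
  rw [← this]
  congr 1
  ext θ
  simp [circleMap, mul_comm]

open InnerProductSpace in
/-- The circle mean of a function lying below a harmonic function on the circle is at most the
value of the harmonic function at the centre. -/
lemma circleMean_le_of_le_harmonic {u : ℂ → EReal} {H : ℂ → ℝ} {z : ℂ} {ρ : ℝ} (hρ : 0 ≤ ρ)
    (hH : HarmonicOnNhd H (Metric.closedBall z ρ))
    (hu : ∀ ζ ∈ Metric.sphere z ρ, u ζ ≤ H ζ) :
    circleMean u z (ρ : ℂ) ≤ H z := by
  have hm : ∀ θ : ℝ, z + Complex.exp (2 * Real.pi * θ * Complex.I) • (ρ : ℂ)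
      ∈ Metric.sphere z ρ := fun θ => by
    have := Complex.norm_exp_ofReal_mul_I (2 * Real.pi * θ)
    push_cast at this
    simp [this, abs_of_nonneg hρ]
  have hc : Continuous fun θ : ℝ =>
      H (z + Complex.exp (2 * Real.pi * θ * Complex.I) • (ρ : ℂ)) := by
    refine (hH.continuousOn.mono Metric.sphere_subset_closedBall).comp_continuous (by fun_prop) hm
  have hi : IntegrableOn (fun θ : ℝ =>
      H (z + Complex.exp (2 * Real.pi * θ * Complex.I) • (ρ : ℂ))) (Ioc 0 1) :=
    hc.integrableOn_Ioc
  have hH' : HarmonicOnNhd H (Metric.closedBall z |ρ|) := by rwa [abs_of_nonneg hρ]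
  rw [← InnerProductSpace.HarmonicOnNhd.circleAverage_eq hH', ← integral_Ioc_eq_circleAverage,
    ← coe_sub_lintegral_eq_integral hi]
  refine EReal.sub_le_sub ?_ ?_
  · exact EReal.coe_ennreal_le_coe_ennreal_iff.2
      (lintegral_mono fun θ => EReal.toENNReal_le_toENNReal (hu _ (hm θ)))
  · exact EReal.coe_ennreal_le_coe_ennreal_iff.2
      (lintegral_mono fun θ => EReal.toENNReal_le_toENNReal (EReal.neg_le_neg_iff.2 (hu _ (hm θ))))

lemma IsPlurisubharmonicOn.comp_line {E : Type*} [NormedAddCommGroup E] [NormedSpace ℂ E]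
    {f : E → EReal} {Ω : Set E} (hf : IsPlurisubharmonicOn f Ω) (x e : E) :
    IsPlurisubharmonicOn (fun ζ : ℂ => f (x + ζ • e)) ((fun ζ : ℂ => x + ζ • e) ⁻¹' Ω) where
  isOpen := hf.isOpen.preimage (by fun_prop)
  lt_top z hz := hf.lt_top _ hz
  upperSemicontinuousOn := hf.upperSemicontinuousOn.comp (by fun_prop) fun z hz => hz
  le_circleMean z w h := by
    have := hf.le_circleMean (x + z • e) (w • e) fun ζ hζ => by
      have := h ζ hζ
      simpa [add_smul, smul_smul, add_assoc] using this
    simpa [circleMean, add_smul, smul_smul, add_assoc] using this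

/-! ### Maximum principle -/

open InnerProductSpace in
/-- The maximum principle: a plurisubharmonic function on a plane domain that lies below a
harmonic function on the boundary of a compact set lies below it on the whole set. -/
lemma IsPlurisubharmonicOn.le_harmonic {u : ℂ → EReal} {Ω K V : Set ℂ} {h : ℂ → ℝ}
    (hu : IsPlurisubharmonicOn u Ω) (hK : IsCompact K) (hKΩ : K ⊆ Ω) (hV : IsOpen V) (hVK : V ⊆ K)
    (hc : ContinuousOn h K) (hh : HarmonicOnNhd h V) (hb : ∀ z ∈ K \ V, u z ≤ h z) :
    ∀ z ∈ K, u z ≤ h z := by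
  intro z₁ hz₁
  by_contra! hlt
  obtain ⟨B, hB⟩ := hK.isBounded.exists_norm_le
  obtain ⟨q, hq₁, hq₂⟩ := EReal.lt_iff_exists_real_btwn.1 hlt
  have hq₁' : h z₁ < q := by exact_mod_cast hq₁
  set ε := (q - h z₁) / (B ^ 2 + 1) with hε
  have hεpos : 0 < ε := div_pos (by linarith) (by positivity)
  have hεB : ε * (B ^ 2 + 1) = q - h z₁ := div_mul_cancel₀ _ (by positivity)
  -- A strictly superharmonic perturbation of `h`, still below `u` at `z₁`: the maximum of `u - k`
  -- is then impossible in `V`.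
  set k : ℂ → ℝ := fun z => h z + ε * (B ^ 2 - ‖z‖ ^ 2) with hk
  have hhk : ∀ z ∈ K, h z ≤ k z := fun z hz => by
    have : 0 ≤ ε * (B ^ 2 - ‖z‖ ^ 2) :=
      mul_nonneg hεpos.le (sub_nonneg.2 (pow_le_pow_left₀ (norm_nonneg _) (hB z hz) 2))
    simp only [hk]; linarith
  have hkq : k z₁ ≤ q := by
    have : 0 ≤ ε * (‖z₁‖ ^ 2 + 1) := by positivity
    simp only [hk]; linarith
  have hkc : ContinuousOn k K := by fun_prop
  have husc : UpperSemicontinuousOn (fun z => u z + ((-k z : ℝ) : EReal)) K := by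
    refine (hu.upperSemicontinuousOn.mono hKΩ).add' ?_ ?_
    · exact (continuous_coe_real_ereal.comp_continuousOn hkc.neg).upperSemicontinuousOn
    · intro z hz
      exact EReal.continuousAt_add (Or.inr (EReal.coe_ne_bot _)) (Or.inr (EReal.coe_ne_top _))
  obtain ⟨z₀, hz₀, hmax⟩ := husc.exists_isMaxOn ⟨z₁, hz₁⟩ hK
  have hpos : 0 < u z₀ + ((-k z₀ : ℝ) : EReal) := by
    refine lt_of_lt_of_le ?_ (hmax hz₁)
    change 0 < u z₁ + ((-k z₁ : ℝ) : EReal)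
    have h1 : ((k z₁ : ℝ) : EReal) < u z₁ := lt_of_le_of_lt (by exact_mod_cast hkq) hq₂
    have h2 := hu.lt_top z₁ (hKΩ hz₁)
    revert h1 h2
    induction u z₁ with
    | bot => simp
    | top => simp
    | coe v =>
      intro h1 _
      norm_cast at h1 ⊢
      linarith
  obtain ⟨v, hv⟩ : ∃ v : ℝ, u z₀ = v := by
    refine ⟨(u z₀).toReal, (EReal.coe_toReal (hu.lt_top z₀ (hKΩ hz₀)).ne ?_).symm⟩
    intro hbot
    simp [hbot] at hpos
  have hvk : 0 < v - k z₀ := by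
    rw [hv] at hpos
    norm_cast at hpos
  have hle : ∀ ζ ∈ K, u ζ ≤ ((v - k z₀ + k ζ : ℝ) : EReal) := by
    intro ζ hζ
    have h1 : u ζ + ((-k ζ : ℝ) : EReal) ≤ u z₀ + ((-k z₀ : ℝ) : EReal) := hmax hζ
    have h2 := hu.lt_top ζ (hKΩ hζ)
    rw [hv] at h1
    revert h1 h2
    induction u ζ with
    | bot => simp
    | top => simp
    | coe a =>
      intro h1 _
      norm_cast at h1 ⊢
      linarith
  have hz₀V : z₀ ∈ V := by
    by_contra hn
    have h1 := hb z₀ ⟨hz₀, hn⟩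
    rw [hv] at h1
    have h2 : v ≤ h z₀ := by exact_mod_cast h1
    linarith [hhk z₀ hz₀]
  obtain ⟨ρ, hρ, hρV⟩ := Metric.nhds_basis_closedBall.mem_iff.1 (hV.mem_nhds hz₀V)
  have hsub := hu.le_circleMean z₀ (ρ : ℂ) fun ζ hζ => hKΩ <| hVK <| hρV <| by
    simpa [abs_of_pos hρ] using mul_le_of_le_one_left hρ.le hζ
  -- On the circle |ζ|² is an affine function of ζ, so `H` is harmonic and equals `v - k z₀ + k`
  -- there, while at the centre it falls short of `v` by `ε * ρ ^ 2`.
  set H : ℂ → ℝ := fun ζ => h ζ + (v - k z₀ + ε * (B ^ 2 - ‖z₀‖ ^ 2 - ρ ^ 2))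
    - ((2 * ε : ℂ) * (starRingEnd ℂ z₀ * (ζ - z₀))).re with hHdef
  have hH : HarmonicOnNhd H (Metric.closedBall z₀ ρ) := by
    intro ζ hζ
    refine ((hh ζ (hρV hζ)).add (harmonicAt_const _)).sub ?_
    exact AnalyticAt.harmonicAt_re (by fun_prop)
  have hmean := circleMean_le_of_le_harmonic (u := u) hρ.le hH fun ζ hζ => by
    refine (hle ζ (hVK (hρV (Metric.sphere_subset_closedBall hζ)))).trans_eq ?_
    have hn : ‖ζ‖ ^ 2 = ‖z₀‖ ^ 2 + ρ ^ 2 + 2 * (starRingEnd ℂ z₀ * (ζ - z₀)).re := by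
      have hζ' : ‖ζ - z₀‖ ^ 2 = ρ ^ 2 := by rw [mem_sphere_iff_norm.1 hζ]
      rw [← hζ']
      simp only [← Complex.normSq_eq_norm_sq, Complex.normSq_apply, Complex.mul_re,
        Complex.conj_re, Complex.conj_im, Complex.sub_re, Complex.sub_im]
      ring
    have h2 : ((2 * ε : ℂ) * (starRingEnd ℂ z₀ * (ζ - z₀))).re
        = 2 * ε * (starRingEnd ℂ z₀ * (ζ - z₀)).re := by
      have := Complex.re_ofReal_mul (2 * ε) (starRingEnd ℂ z₀ * (ζ - z₀))
      push_cast at this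
      exact this
    congr 1
    simp only [hHdef, h2]
    have : k ζ = h ζ + ε * (B ^ 2 - ‖ζ‖ ^ 2) := rfl
    rw [this, hn]
    ring
  have hfin := hsub.trans hmean
  rw [hv] at hfin
  have hfin' : v ≤ H z₀ := by exact_mod_cast hfin
  have hHz : H z₀ = v - ε * ρ ^ 2 := by
    simp only [hHdef, hk, sub_self, mul_zero, Complex.zero_re]
    ring
  have : 0 < ε * ρ ^ 2 := by positivity
  linarith

/-! ### Three circles -/

open InnerProductSpace in
/-- Hadamard's three circles theorem for a nonpositive plurisubharmonic function. -/
lemma IsPlurisubharmonicOn.three_circles {E : Type*} [NormedAddCommGroup E] [NormedSpace ℂ E]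
    {f : E → EReal} {Ω : Set E} (hf : IsPlurisubharmonicOn f Ω) {x z : E} {t R m : ℝ}
    (ht : 0 < t) (htR : t < R) (hΩ : Metric.closedBall x R ⊆ Ω)
    (hm : ∀ y ∈ Metric.closedBall x t, f y ≤ (m : EReal))
    (hR : ∀ y ∈ Metric.closedBall x R, f y ≤ 0) (hz₁ : t ≤ ‖z - x‖) (hz₂ : ‖z - x‖ ≤ R) :
    f z ≤ ((m * (Real.log (R / ‖z - x‖) / Real.log (R / t)) : ℝ) : EReal) := by
  have hR0 : 0 < R := ht.trans htR
  set d := ‖z - x‖ with hd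
  have hd0 : 0 < d := ht.trans_le hz₁
  set e : E := ((d⁻¹ : ℝ) : ℂ) • (z - x) with he
  have hne : ‖e‖ = 1 := by
    rw [he, norm_smul, ← hd, Complex.norm_real, Real.norm_of_nonneg (by positivity),
      inv_mul_cancel₀ hd0.ne']
  have hdist : ∀ ζ : ℂ, dist (x + ζ • e) x = ‖ζ‖ := fun ζ => by
    simp [dist_eq_norm, norm_smul, hne]
  have hL : 0 < Real.log (R / t) := Real.log_pos ((one_lt_div ht).2 htR)
  set h : ℂ → ℝ := fun ζ => m * (Real.log (R / ‖ζ‖) / Real.log (R / t)) with hh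
  have hh' : ∀ ζ : ℂ, ζ ≠ 0 →
      h ζ = m * Real.log R / Real.log (R / t) - (m / Real.log (R / t)) * Real.log ‖ζ‖ :=
    fun ζ hζ => by
      simp only [hh]
      rw [Real.log_div hR0.ne' (norm_ne_zero_iff.2 hζ)]
      ring
  have key := (hf.comp_line x e).le_harmonic (K := {ζ | t ≤ ‖ζ‖ ∧ ‖ζ‖ ≤ R})
    (V := {ζ | t < ‖ζ‖ ∧ ‖ζ‖ < R}) (h := h) ?_ ?_ ?_ ?_ ?_ ?_ ?_ (d : ℂ) ?_
  · have h1 : x + (d : ℂ) • e = z := by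
      rw [he, smul_smul, ← Complex.ofReal_mul, mul_inv_cancel₀ hd0.ne']
      simp
    simpa only [h1, hh, Complex.norm_real, Real.norm_of_nonneg hd0.le] using key
  · refine (isCompact_closedBall (0 : ℂ) R).of_isClosed_subset ?_ fun ζ hζ => by simpa using hζ.2
    exact (isClosed_le continuous_const continuous_norm).inter
      (isClosed_le continuous_norm continuous_const)
  · intro ζ hζ
    exact hΩ (by rw [Metric.mem_closedBall, hdist]; exact hζ.2)
  · exact (isOpen_lt continuous_const continuous_norm).inter
      (isOpen_lt continuous_norm continuous_const)
  · exact fun ζ hζ => ⟨hζ.1.le, hζ.2.le⟩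
  · have h0 : ∀ ζ ∈ {ζ : ℂ | t ≤ ‖ζ‖ ∧ ‖ζ‖ ≤ R}, ζ ≠ 0 := fun ζ hζ =>
      norm_pos_iff.1 (ht.trans_le hζ.1)
    refine ContinuousOn.congr ?_ fun ζ hζ => hh' ζ (h0 ζ hζ)
    refine continuousOn_const.sub (continuousOn_const.mul ?_)
    exact continuous_norm.continuousOn.log fun ζ hζ => norm_ne_zero_iff.2 (h0 ζ hζ)
  · intro ζ hζ
    have h0 : ζ ≠ 0 := norm_pos_iff.1 (ht.trans hζ.1)
    have h1 : HarmonicAt (fun ζ : ℂ => Real.log ‖ζ‖) ζ :=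
      AnalyticAt.harmonicAt_log_norm (f := fun ζ => ζ) analyticAt_id h0
    refine (harmonicAt_congr_nhds ?_).2 ((harmonicAt_const
      (m * Real.log R / Real.log (R / t))).sub (h1.const_smul (c := m / Real.log (R / t))))
    filter_upwards [isOpen_ne.mem_nhds h0] with w hw
    simpa using hh' w hw
  · rintro ζ ⟨⟨h1, h2⟩, h3⟩
    rcases h1.eq_or_lt with h1 | h1
    · have : h ζ = m := by
        simp only [hh, ← h1]
        rw [div_self hL.ne', mul_one]
      rw [this]
      exact hm _ (by rw [Metric.mem_closedBall, hdist, ← h1])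
    · have h4 : ‖ζ‖ = R := le_antisymm h2 (not_lt.1 fun h4 => h3 ⟨h1, h4⟩)
      have : h ζ = 0 := by
        simp only [hh, h4]
        rw [div_self hR0.ne']; simp
      rw [this]
      exact hR _ (by rw [Metric.mem_closedBall, hdist, h4])
  · simpa [abs_of_pos hd0] using ⟨hz₁, hz₂⟩

/-! ### Chains of balls and the lower bound for the supremum -/

section Chain

variable {E : Type*} [NormedAddCommGroup E] [NormedSpace ℂ E] {f : E → EReal} {Ω : Set E}

/-- The ball about `y` lies within δ/2 of `x`, and three circles with radii δ/4 and δ gives the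
factor at least log 2 / log 4 = 1/2 there. -/
lemma IsPlurisubharmonicOn.le_half_of_dist_le (hf : IsPlurisubharmonicOn f Ω)
    (hΩ : ∀ z ∈ Ω, f z ≤ 0) {δ m : ℝ} (hδ : 0 < δ) (hm : m ≤ 0) {x y : E}
    (hx : Metric.closedBall x δ ⊆ Ω) (hxy : dist x y ≤ δ / 4)
    (hle : ∀ z ∈ Metric.closedBall x (δ / 4), f z ≤ (m : EReal)) :
    ∀ z ∈ Metric.closedBall y (δ / 4), f z ≤ ((m / 2 : ℝ) : EReal) := by
  intro z hz
  have hzx : dist z x ≤ δ / 2 := by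
    have := dist_triangle z y x
    rw [Metric.mem_closedBall] at hz
    rw [dist_comm] at hxy
    linarith
  rcases le_total (dist z x) (δ / 4) with h | h
  · exact (hle z h).trans (by exact_mod_cast (by linarith : m ≤ m / 2))
  · rw [dist_eq_norm] at h hzx
    have hd : 0 < ‖z - x‖ := lt_of_lt_of_le (by positivity) h
    refine (hf.three_circles (t := δ / 4) (R := δ) (by positivity) (by linarith) hx hle
      (fun w hw => hΩ w (hx hw)) h (by linarith)).trans ?_
    have h4 : δ / (δ / 4) = 2 ^ 2 := by field_simp; norm_num
    have hl2 : 0 < Real.log 2 := Real.log_pos one_lt_two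
    have hlog : Real.log 2 ≤ Real.log (δ / ‖z - x‖) :=
      Real.log_le_log two_pos (by rw [le_div_iff₀ hd]; linarith)
    rw [h4, Real.log_pow]
    have : (1 : ℝ) / 2 ≤ Real.log (δ / ‖z - x‖) / (((2 : ℕ) : ℝ) * Real.log 2) := by
      rw [le_div_iff₀ (by positivity)]
      push_cast
      linarith
    exact_mod_cast (by nlinarith : m * _ ≤ m / 2)

/-- Iterates the halving along `N` equal steps of the segment from `x` to `y`. -/
lemma IsPlurisubharmonicOn.le_div_two_pow (hf : IsPlurisubharmonicOn f Ω)
    (hΩ : ∀ z ∈ Ω, f z ≤ 0) {δ m : ℝ} (hδ : 0 < δ) (hm : m ≤ 0) {S : Set E}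
    (hS : Convex ℝ S) (hSΩ : ∀ z ∈ S, Metric.closedBall z δ ⊆ Ω) {x y : E} (hx : x ∈ S)
    (hy : y ∈ S) {N : ℕ} (hN : 0 < N) (hxy : dist x y ≤ N * (δ / 4))
    (hle : ∀ z ∈ Metric.closedBall x (δ / 4), f z ≤ (m : EReal)) :
    f y ≤ ((m / 2 ^ N : ℝ) : EReal) := by
  have hN' : (0 : ℝ) < N := by exact_mod_cast hN
  have main : ∀ i : ℕ, i ≤ N → ∀ z ∈ Metric.closedBall
      (AffineMap.lineMap x y ((i : ℝ) / N)) (δ / 4), f z ≤ ((m / 2 ^ i : ℝ) : EReal) := by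
    intro i
    induction i with
    | zero => simpa using hle
    | succ i ih =>
      intro hi
      have h := hf.le_half_of_dist_le hΩ hδ
        (div_nonpos_of_nonpos_of_nonneg hm (by positivity : (0 : ℝ) ≤ 2 ^ i))
        (x := AffineMap.lineMap x y ((i : ℝ) / N))
        (y := AffineMap.lineMap x y (((i + 1 : ℕ) : ℝ) / N)) ?_ ?_ (ih (by omega))
      · rwa [div_div, ← pow_succ] at h
      · refine hSΩ _ (hS.lineMap_mem hx hy ⟨by positivity, ?_⟩)
        rw [div_le_one hN']
        exact_mod_cast (by omega : i ≤ N)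
      · rw [dist_lineMap_lineMap, Real.dist_eq, ← sub_div]
        push_cast
        rw [sub_add_cancel_left, abs_div, abs_neg, abs_one, abs_of_pos hN', div_mul_eq_mul_div,
          one_mul, div_le_iff₀ hN']
        linarith
  have h := main N le_rfl y
  rw [div_self hN'.ne', AffineMap.lineMap_apply_one] at h
  exact h (Metric.mem_closedBall_self (by positivity))

/-- A nonpositive plurisubharmonic function that exceeds `-2` at some point cannot be too small on
a whole ball. -/
lemma IsPlurisubharmonicOn.neg_le_log (hf : IsPlurisubharmonicOn f Ω)
    (hΩ : ∀ z ∈ Ω, f z ≤ 0) {δ m : ℝ} (hδ : 0 < δ) (hm : m ≤ 0) {S : Set E}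
    (hS : Convex ℝ S) (hSΩ : ∀ z ∈ S, Metric.closedBall z δ ⊆ Ω) {x y : E} (hx : x ∈ S)
    (hy : y ∈ S) {N : ℕ} (hN : 0 < N) (hxy : dist x y ≤ N * (δ / 4)) (hfy : ((-2 : ℝ) : EReal) < f y)
    {t R q : ℝ} (ht : 0 < t) (hδR : δ ≤ R) (hq : 1 < q) (hqR : q ≤ R / t)
    (hle : ∀ z ∈ Metric.closedBall x t, f z ≤ (m : EReal)) :
    -m ≤ 2 ^ (N + 1) * (1 / Real.log 4 + 1 / Real.log q) * Real.log (R / t) := by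
  have hlq : 0 < Real.log q := Real.log_pos hq
  have hl4 : 0 < Real.log 4 := Real.log_pos (by norm_num)
  have hlR : Real.log q ≤ Real.log (R / t) := Real.log_le_log (by linarith) hqR
  have bound : ∀ m' : ℝ, m' ≤ 0 →
      (∀ z ∈ Metric.closedBall x (δ / 4), f z ≤ (m' : EReal)) → -m' ≤ 2 ^ (N + 1) := by
    intro m' hm' h
    have h1 := hfy.trans_le (hf.le_div_two_pow hΩ hδ hm' hS hSΩ hx hy hN hxy h)
    have h2 : (-2 : ℝ) < m' / 2 ^ N := EReal.coe_lt_coe_iff.1 h1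
    rw [lt_div_iff₀ (by positivity)] at h2
    rw [pow_succ]
    linarith
  rcases le_or_gt (δ / 4) t with h | h
  · have h1 := bound m hm fun z hz => hle z (Metric.closedBall_subset_closedBall h hz)
    have h2 : 1 ≤ (1 / Real.log 4 + 1 / Real.log q) * Real.log (R / t) := by
      have h3 : 1 ≤ 1 / Real.log q * Real.log (R / t) := by
        rw [div_mul_eq_mul_div, one_mul, one_le_div hlq]
        exact hlR
      have h4 : 0 ≤ 1 / Real.log 4 * Real.log (R / t) := by
        have := hlq.trans_le hlR
        positivity
      linarith
    rw [mul_assoc]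
    exact h1.trans (le_mul_of_one_le_right (by positivity) h2)
  · have h4 : (4 : ℝ) < δ / t := by rw [lt_div_iff₀ ht]; linarith
    have hl : Real.log 4 < Real.log (δ / t) := Real.log_lt_log (by norm_num) h4
    have hl0 : 0 < Real.log (δ / t) := hl4.trans hl
    have hlδ : Real.log (δ / t) ≤ Real.log (R / t) :=
      Real.log_le_log (by linarith) (by gcongr)
    -- Three circles with radii `t` and `δ`, evaluated at radius δ/4.
    set θ := Real.log 4 / Real.log (δ / t) with hθ
    have hθ0 : 0 < θ := div_pos hl4 hl0
    have hθ1 : θ ≤ 1 := (div_le_one hl0).2 hl.le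
    have h1 := bound (m * θ) (mul_nonpos_of_nonpos_of_nonneg hm hθ0.le) fun z hz => by
      rcases le_total (dist z x) t with hzt | hzt
      · exact (hle z hzt).trans (by exact_mod_cast (by nlinarith : m ≤ m * θ))
      · rw [Metric.mem_closedBall, dist_eq_norm] at hz
        rw [dist_eq_norm] at hzt
        refine (hf.three_circles ht (by linarith) (hSΩ x hx) hle
          (fun w hw => hΩ w (hSΩ x hx hw)) hzt (by linarith)).trans ?_
        have hd : 0 < ‖z - x‖ := ht.trans_le hzt
        have : θ ≤ Real.log (δ / ‖z - x‖) / Real.log (δ / t) := by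
          refine div_le_div_of_nonneg_right (Real.log_le_log (by norm_num) ?_) hl0.le
          rw [le_div_iff₀ hd]; linarith
        exact_mod_cast mul_le_mul_of_nonpos_left this hm
    have h2 : -m ≤ 2 ^ (N + 1) / θ := by
      rw [le_div_iff₀ hθ0]; linarith
    refine h2.trans ?_
    rw [mul_assoc, div_eq_mul_inv]
    gcongr
    rw [hθ, inv_div, add_mul]
    have h5 : Real.log (δ / t) / Real.log 4 ≤ 1 / Real.log 4 * Real.log (R / t) := by
      rw [div_mul_eq_mul_div, one_mul]
      gcongr
    have h6 : 0 ≤ 1 / Real.log q * Real.log (R / t) := by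
      have := hlq.trans_le hlR
      positivity
    linarith

end Chain

/-! ### Assembling the inequality -/

lemma norm_add_lt_of_ball_subset {E : Type*} [NormedAddCommGroup E] [NormedSpace ℝ E]
    [Nontrivial E] {x : E} {τ R d : ℝ} (h : Metric.ball x τ ⊆ Metric.ball 0 R) (hd : 0 ≤ d)
    (hdτ : d < τ) : ‖x‖ + d < R := by
  obtain ⟨v, hv, hxv⟩ : ∃ v : E, ‖v‖ = 1 ∧ x = ‖x‖ • v := by
    rcases eq_or_ne x 0 with rfl | hx
    · obtain ⟨v, hv⟩ := exists_norm_eq E zero_le_one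
      exact ⟨v, hv, by simp⟩
    · have hx' := norm_ne_zero_iff.2 hx
      exact ⟨‖x‖⁻¹ • x, by simp [norm_smul, hx'], by simp [smul_smul, hx']⟩
  have h1 : x + d • v ∈ Metric.ball x τ := by
    simpa [Metric.mem_ball, dist_eq_norm, norm_smul, hv, abs_of_nonneg hd] using hdτ
  have h2 := h h1
  rw [mem_ball_zero_iff] at h2
  have h3 : x + d • v = (‖x‖ + d) • v := by rw [add_smul, ← hxv]
  rwa [h3, norm_smul, hv, mul_one, Real.norm_of_nonneg (by positivity)] at h2

theorem mainTheorem2 (r : ℝ) (hr : 1 < r) :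
    ∃ c : ℝ, 0 < c ∧
      ∀ (n : ℕ) (f : EuclideanSpace ℂ (Fin n) → EReal),
        IsPlurisubharmonicOn f (Metric.ball 0 r) →
        (⨆ z ∈ Metric.ball (0 : EuclideanSpace ℂ (Fin n)) r, f z) ≤ 0 →
        -1 ≤ (⨆ z ∈ Metric.ball (0 : EuclideanSpace ℂ (Fin n)) 1, f z) →
        ∀ (a : ℝ), 1 < a → ∀ (x : EuclideanSpace ℂ (Fin n)) (t : ℝ), 0 < t →
          Metric.ball x (a * t) ⊆ Metric.ball 0 1 →
          ∀ s ∈ Set.Icc 1 a,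
            (⨆ z ∈ Metric.ball x (s * t), f z)
              ≤ ((c * Real.log s : ℝ) : EReal) + ⨆ z ∈ Metric.ball x t, f z := by
  obtain ⟨q, hq, hqr⟩ := exists_between hr
  -- Enough steps of length (q - 1)/4 to cross the unit ball, of diameter 2.
  set N := ⌈8 / (q - 1)⌉₊ with hN
  have hδ : 0 < q - 1 := by linarith
  have hNpos : 0 < N := Nat.ceil_pos.2 (by positivity)
  have hN8 : 2 ≤ N * ((q - 1) / 4) := by
    have h1 := Nat.le_ceil (8 / (q - 1))
    rw [div_le_iff₀ hδ] at h1
    linarith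
  have hlq : 0 < Real.log q := Real.log_pos hq
  have hl4 : 0 < Real.log 4 := Real.log_pos (by norm_num)
  set c := 2 ^ (N + 1) * (1 / Real.log 4 + 1 / Real.log q) with hc
  have hcpos : 0 < c := by positivity
  refine ⟨c, hcpos, ?_⟩
  intro n f hf hf0 hf1 a ha x t ht hsub s hs
  have hf0' : ∀ z ∈ Metric.ball (0 : EuclideanSpace ℂ (Fin n)) r, f z ≤ 0 :=
    fun z hz => (le_iSup₂ (f := fun z _ => f z) z hz).trans hf0
  obtain ⟨y, hy, hfy⟩ : ∃ y ∈ Metric.ball (0 : EuclideanSpace ℂ (Fin n)) 1,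
      ((-2 : ℝ) : EReal) < f y := by
    have h21 : ((-2 : ℝ) : EReal) < -1 :=
      EReal.coe_lt_coe_iff.2 (by norm_num : (-2 : ℝ) < -1)
    simpa only [lt_iSup_iff, exists_prop] using h21.trans_le hf1
  have hs0 : 0 < s := one_pos.trans_le hs.1
  have hlogs : 0 ≤ Real.log s := Real.log_nonneg hs.1
  set M := ⨆ z ∈ Metric.ball x t, f z with hM
  have hleM : ∀ z ∈ Metric.ball x t, f z ≤ M := fun z hz => le_iSup₂ (f := fun z _ => f z) z hz
  refine iSup₂_le fun z hz => ?_
  rcases lt_or_ge (dist z x) t with hzt | hzt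
  · refine (hleM z hzt).trans (le_add_of_nonneg_left ?_)
    exact_mod_cast mul_nonneg hcpos.le hlogs
  have hzx : z ≠ x := dist_pos.1 (ht.trans_le hzt)
  have : Nontrivial (EuclideanSpace ℂ (Fin n)) := ⟨z, x, hzx⟩
  rw [Metric.mem_ball] at hz
  set d := dist z x with hd
  have hd0 : 0 < d := ht.trans_le hzt
  have hxd : ‖x‖ + d < 1 := norm_add_lt_of_ball_subset hsub hd0.le
    (hz.trans_le (mul_le_mul_of_nonneg_right hs.2 ht.le))
  -- Since `t' < t`, the closed ball of radius `t'` lies in the open ball defining `M`, and log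
  -- (R/d) = log (R/t') - log s exactly.
  set t' := d / s with ht'
  have ht'0 : 0 < t' := div_pos hd0 hs0
  have ht't : t' < t := by rw [ht', div_lt_iff₀ hs0]; linarith
  -- This keeps the ball within radius `q < r`; as t' ≤ 1 - ‖x‖, the ratio R/t' is at least `q`
  -- however close `x` is to the unit sphere.
  set R := q - ‖x‖ with hR
  have hballs : ∀ w ∈ Metric.ball (0 : EuclideanSpace ℂ (Fin n)) 1,
      Metric.closedBall w (q - 1) ⊆ Metric.ball 0 r := fun w hw => by
    rw [mem_ball_zero_iff] at hw
    exact Metric.closedBall_subset_ball' (by rw [dist_zero_right]; linarith)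
  have hRr : Metric.closedBall x R ⊆ Metric.ball 0 r :=
    Metric.closedBall_subset_ball' (by rw [dist_zero_right]; linarith)
  have hx1 : x ∈ Metric.ball (0 : EuclideanSpace ℂ (Fin n)) 1 := by
    rw [mem_ball_zero_iff]; linarith
  have hxy : dist x y ≤ N * ((q - 1) / 4) := by
    refine le_trans ?_ hN8
    have h1 := dist_triangle_right x y 0
    have h2 : dist x 0 < 1 := hx1
    have h3 : dist y 0 < 1 := hy
    linarith
  have hqR : q ≤ R / t' := by
    rw [le_div_iff₀ ht'0, hR]
    have : t' ≤ 1 - ‖x‖ := by linarith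
    nlinarith [norm_nonneg x, mul_le_mul_of_nonneg_left this (by linarith : 0 ≤ q)]
  have hlow : ∀ m : ℝ, m ≤ 0 → M ≤ m → -m ≤ c * Real.log (R / t') := fun m hm hMm =>
    hf.neg_le_log hf0' hδ hm (convex_ball 0 1) hballs hx1 hy hNpos hxy hfy ht'0
      (by linarith) hq hqR
      fun w hw => (hleM w (Metric.closedBall_subset_ball ht't hw)).trans hMm
  have hLpos : 0 < Real.log (R / t') := Real.log_pos (hq.trans_le hqR)
  have hM0 : M ≤ 0 := iSup₂_le fun w hw => hf0' w <| hRr <|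
    Metric.closedBall_subset_closedBall (by linarith) (Metric.ball_subset_closedBall hw)
  obtain ⟨m, hm⟩ : ∃ m : ℝ, M = m := by
    refine ⟨M.toReal, (EReal.coe_toReal (hM0.trans_lt EReal.zero_lt_top).ne fun hbot => ?_).symm⟩
    -- If M were -∞, every `m ≤ 0` would be admissible, including one violating the lower bound.
    have h1 := hlow (-(c * Real.log (R / t') + 1)) (by linarith [mul_pos hcpos hLpos])
      (by rw [hbot]; exact bot_le)
    linarith
  rw [hm] at hM0 hleM ⊢
  have hm0 : m ≤ 0 := by exact_mod_cast hM0
  have hcm := hlow m hm0 hm.le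
  have hdn : ‖z - x‖ = d := (dist_eq_norm z x).symm
  have h3 := hf.three_circles ht'0 (by linarith) hRr
    (fun w hw => hleM w (Metric.closedBall_subset_ball ht't hw)) (fun w hw => hf0' w (hRr hw))
    (z := z) (by rw [hdn]; linarith) (by rw [hdn]; linarith)
  refine h3.trans ?_
  have hR0 : 0 < R := by linarith
  have hlogd : Real.log (R / d) = Real.log (R / t') - Real.log s := by
    rw [← Real.log_div (by positivity) hs0.ne', ht']
    congr 1
    field_simp
  rw [hdn, hlogd, ← EReal.coe_add, EReal.coe_le_coe_iff, sub_div, div_self hLpos.ne', mul_sub,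
    mul_one]
  have h4 : -m * (Real.log s / Real.log (R / t')) ≤ c * Real.log s := by
    rw [mul_div_assoc', div_le_iff₀ hLpos]
    calc -m * Real.log s ≤ c * Real.log (R / t') * Real.log s := by gcongr
      _ = c * Real.log s * Real.log (R / t') := by ring
  linarith
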